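/- Let $M\subseteq\mathcal L(H)$ and $N\subseteq\mathcal L(K)$ be von Neumann algebras, acting on complex Hilbert spaces $H$ and $K$, and let $M\overline{\otimes}N\subseteq\mathcal L(H\otimes K)$ be their von Neumann tensor product. Inner products are linear in the second variable, and $\omega_{v,w}:=\langle v\mid\bullet\, w\rangle$ denotes the vector functional of $v,w$. For $x\in M\overline{\otimes}N$ and a bounded functional $\varphi\in M^*$ (not necessarily normal), the slice $(\varphi\otimes\mathrm{id})x\in N$ is the operator with $$\langle v\mid (\varphi\otimes\mathrm{id})x\; w\rangle=\varphi\big((\mathrm{id}\otimes\omega_{v,w})x\big)\qquad(v,w\in K),$$ where $(\mathrm{id}\otimes\omega_{v,w})x\in M$ is given by $\langle a\mid(\mathrm{id}\otimes\omega_{v,w})x\;a'\rangle=\langle a\otimes v\mid x(a'\otimes w)\rangle$ for $a,a'\in H$. The slices $(\mathrm{id}\otimes\psi)x\in M$, $\psi\in N^*$, are defined symmetrically. The weak$^*$ topology of $M^*$ is that of pointwise convergence on $M$. Then, for every $x\in M\overline{\otimes}N$, the following eight conditions, $(a)_\ell$–$(d)_\ell$ and $(a)_r$–$(d)_r$, are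 equivalent. * $(a)_\ell$ The map $M^*\ni\varphi\mapsto(\varphi\otimes\mathrm{id})x\in N$ is weak$^*$-to-norm continuous on the unit ball of $M^*$. * $(b)_\ell$ For every norm-bounded net $(\varphi_\lambda)$ of weak$^*$-continuous (i.e. normal, $\varphi_\lambda\in M_*$) functionals on $M$ that converges to $0$ in the weak$^*$ topology of $M^*$, one has $\|(\varphi_\lambda\otimes\mathrm{id})x\|\to0$. * $(c)_\ell$ The same as $(b)_\ell$, for norm-bounded nets of weakly continuous functionals, i.e. functionals on $M$ that are continuous for the weak operator topology of $M\subseteq\mathcal L(H)$. * $(d)_\ell$ For every norm-bounded net of vector functionals $\omega_{v_\lambda,w_\lambda}\in M_*$, $v_\lambda,w_\lambda\in H$, that is weak$^*$-Cauchy (Cauchy at each element of $M$), the net $\big((\omega_{v_\lambda,w_\lambda}\otimes\mathrm{id})x\big)_\lambda$ is norm-Cauchy in $N$. * $(a)_r$–$(d)_r$ The same conditions for the right-hand slice map $N^*\ni\psi\mapsto(\mathrm{id}\otimes\psi)x\in M$, with $N$ and $K$ in place of $M$ and $H$. -/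

import Mathlib

open scoped TensorProduct InnerProductSpace Topology
open Filter

/-- A von Neumann algebra is a complex subspace of the bounded operators; with this instance its
elements form a normed space, with the operator norm. -/
instance VonNeumannAlgebra.instSMulMemClass {H : Type*} [NormedAddCommGroup H]
    [InnerProductSpace ℂ H] [CompleteSpace H] :
    SMulMemClass (VonNeumannAlgebra H) ℂ (H →L[ℂ] H) where
  smul_mem {s} r _ ha := s.toStarSubalgebra.smul_mem ha r

namespace VNSlice

noncomputable section

/-! ### Hilbert space tensor product -/

/-- The Hilbert space tensor product: the completion of the algebraic tensor product for
`⟪a ⊗ b, c ⊗ d⟫ = ⟪a, c⟫ * ⟪b, d⟫`. -/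
abbrev HilbertTensor (H K : Type*) [NormedAddCommGroup H] [InnerProductSpace ℂ H]
    [NormedAddCommGroup K] [InnerProductSpace ℂ K] : Type _ :=
  UniformSpace.Completion (H ⊗[ℂ] K)

section Tensor

variable {H K : Type*} [NormedAddCommGroup H] [InnerProductSpace ℂ H]
  [NormedAddCommGroup K] [InnerProductSpace ℂ K]

variable (H K) in
/-- The bounded bilinear map `(h, k) ↦ h ⊗ k` into the Hilbert space tensor product. -/
def tmulL : H →L[ℂ] K →L[ℂ] HilbertTensor H K :=
  (ContinuousLinearMap.compL ℂ K (H ⊗[ℂ] K) (HilbertTensor H K)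
    UniformSpace.Completion.toComplL).comp (TensorProduct.mkL ℂ H K)

theorem tmulL_apply (h : H) (k : K) :
    tmulL H K h k = ((h ⊗ₜ[ℂ] k : H ⊗[ℂ] K) : HilbertTensor H K) := rfl

theorem norm_tmulL_apply (h : H) (k : K) : ‖tmulL H K h k‖ = ‖h‖ * ‖k‖ := by
  rw [tmulL_apply, UniformSpace.Completion.norm_coe, TensorProduct.norm_tmul]

/-- The operator `a ⊗ b` on the Hilbert space tensor product. -/
def opTensor (a : H →L[ℂ] H) (b : K →L[ℂ] K) : HilbertTensor H K →L[ℂ] HilbertTensor H K :=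
  (TensorProduct.mapL a b).completion

theorem opTensor_coe (a : H →L[ℂ] H) (b : K →L[ℂ] K) (t : H ⊗[ℂ] K) :
    opTensor a b (t : HilbertTensor H K) = (TensorProduct.mapL a b t : H ⊗[ℂ] K) := by
  exact ContinuousLinearMap.completion_apply_coe _ _

theorem opTensor_tmulL (a : H →L[ℂ] H) (b : K →L[ℂ] K) (h : H) (k : K) :
    opTensor a b (tmulL H K h k) = tmulL H K (a h) (b k) := by
  rw [tmulL_apply, opTensor_coe]; rfl

/-- Bounded operators on the Hilbert space tensor product agree when they agree on elementary
tensors. -/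
theorem ext_tmulL {T : Type*} [NormedAddCommGroup T] [NormedSpace ℂ T]
    {f g : HilbertTensor H K →L[ℂ] T}
    (hfg : ∀ h k, f (tmulL H K h k) = g (tmulL H K h k)) : f = g := by
  ext z
  induction z using UniformSpace.Completion.induction_on with
  | hp => exact isClosed_eq f.continuous g.continuous
  | ih t =>
    induction t using TensorProduct.induction_on with
    | zero => rw [UniformSpace.Completion.coe_zero, map_zero, map_zero]
    | tmul h k => exact hfg h k
    | add s t hs ht => rw [UniformSpace.Completion.coe_add, map_add, map_add, hs, ht]

theorem opTensor_mul (a a' : H →L[ℂ] H) (b b' : K →L[ℂ] K) :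
    opTensor a b * opTensor a' b' = opTensor (a * a') (b * b') := by
  refine ext_tmulL fun h k ↦ ?_
  simp only [mul_apply_eq_comp, opTensor_tmulL]

theorem star_opTensor [CompleteSpace H] [CompleteSpace K] (a : H →L[ℂ] H) (b : K →L[ℂ] K) :
    star (opTensor a b) = opTensor (star a) (star b) := by
  refine ext_tmulL fun h k ↦ ?_
  refine ext_inner_left ℂ fun z ↦ ?_
  rw [ContinuousLinearMap.star_eq_adjoint, ContinuousLinearMap.adjoint_inner_right]
  rw [← inner_conj_symm, ← inner_conj_symm z]
  congr 1
  have : (innerSL ℂ (tmulL H K h k)).comp (opTensor a b) =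
      innerSL ℂ (opTensor (star a) (star b) (tmulL H K h k)) := by
    refine ext_tmulL fun h' k' ↦ ?_
    simp only [ContinuousLinearMap.comp_apply, innerSL_apply_apply, opTensor_tmulL]
    simp only [tmulL_apply, UniformSpace.Completion.inner_coe, TensorProduct.inner_tmul,
      ContinuousLinearMap.star_eq_adjoint, ContinuousLinearMap.adjoint_inner_left]
  exact congrArg (fun f ↦ f z) this

end Tensor

/-! ### The von Neumann tensor product -/

section VN

variable {H K : Type*} [NormedAddCommGroup H] [InnerProductSpace ℂ H] [CompleteSpace H]
  [NormedAddCommGroup K] [InnerProductSpace ℂ K] [CompleteSpace K]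

/-- The operators `a ⊗ b` with `a ∈ M` and `b ∈ N`. -/
def elementaryOps (M : VonNeumannAlgebra H) (N : VonNeumannAlgebra K) :
    Set (HilbertTensor H K →L[ℂ] HilbertTensor H K) :=
  {c | ∃ a ∈ M, ∃ b ∈ N, c = opTensor a b}

/-- The von Neumann tensor product: the von Neumann algebra on the Hilbert space tensor product
generated by (i.e. the double commutant of) the operators `a ⊗ b` with `a ∈ M` and `b ∈ N`. -/
def vnTensor (M : VonNeumannAlgebra H) (N : VonNeumannAlgebra K) :
    VonNeumannAlgebra (HilbertTensor H K) where
  toStarSubalgebra := StarSubalgebra.centralizer ℂ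
    (SetLike.coe (StarSubalgebra.centralizer ℂ (elementaryOps M N)))
  centralizer_centralizer' := by
    have h := StarSubalgebra.coe_centralizer_centralizer ℂ (elementaryOps M N)
    change Set.centralizer (Set.centralizer (SetLike.coe (StarSubalgebra.centralizer ℂ
      (SetLike.coe (StarSubalgebra.centralizer ℂ (elementaryOps M N)))))) =
      SetLike.coe (StarSubalgebra.centralizer ℂ
        (SetLike.coe (StarSubalgebra.centralizer ℂ (elementaryOps M N))))
    rw [h, Set.centralizer_centralizer_centralizer]

theorem coe_vnTensor (M : VonNeumannAlgebra H) (N : VonNeumannAlgebra K) :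
    (vnTensor M N : Set (HilbertTensor H K →L[ℂ] HilbertTensor H K)) =
      Set.centralizer (Set.centralizer (elementaryOps M N ∪ star (elementaryOps M N))) :=
  StarSubalgebra.coe_centralizer_centralizer ℂ (elementaryOps M N)

variable {M : VonNeumannAlgebra H} {N : VonNeumannAlgebra K}

theorem opTensor_mem_vnTensor {a : H →L[ℂ] H} {b : K →L[ℂ] K} (ha : a ∈ M) (hb : b ∈ N) :
    opTensor a b ∈ vnTensor M N := by
  rw [← SetLike.mem_coe, coe_vnTensor]
  exact Set.subset_centralizer_centralizer (Or.inl ⟨a, ha, b, hb, rfl⟩)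

theorem vnTensor_comm {x : HilbertTensor H K →L[ℂ] HilbertTensor H K} (hx : x ∈ vnTensor M N)
    {c : H →L[ℂ] H} {d : K →L[ℂ] K} (hc : c ∈ M.commutant) (hd : d ∈ N.commutant) :
    opTensor c d * x = x * opTensor c d := by
  rw [← SetLike.mem_coe, coe_vnTensor] at hx
  rw [VonNeumannAlgebra.mem_commutant_iff] at hc hd
  refine hx _ ?_
  rintro y (⟨a, ha, b, hb, rfl⟩ | ⟨a, ha, b, hb, h⟩)
  · rw [opTensor_mul, opTensor_mul, hc a ha, hd b hb]
  · rw [← star_star y, h, star_opTensor, opTensor_mul, opTensor_mul, hc _ (star_mem ha),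
      hd _ (star_mem hb)]

end VN

/-! ### Slice maps -/

section Slice

variable {A B T : Type*} [NormedAddCommGroup A] [InnerProductSpace ℂ A] [CompleteSpace A]
  [NormedAddCommGroup B] [InnerProductSpace ℂ B]
  [NormedAddCommGroup T] [InnerProductSpace ℂ T] [CompleteSpace T]

/-- For a bounded bilinear map `τ : A × B → T` and an operator `x` on `T`, the operator on `A` with
matrix coefficients `⟪a, compression τ x v w a'⟫ = ⟪τ a v, x (τ a' w)⟫`. For `τ = tmulL H K` it
is the slice `(id ⊗ ω_{v,w}) x`, and for the flip of `tmulL H K` it is `(ω_{v,w} ⊗ id) x`, where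
`ω_{v,w} = ⟪v, · w⟫`. -/
def compression (τ : A →L[ℂ] B →L[ℂ] T) (x : T →L[ℂ] T) (v w : B) : A →L[ℂ] A :=
  (ContinuousLinearMap.adjoint (τ.flip v)).comp (x.comp (τ.flip w))

theorem inner_compression (τ : A →L[ℂ] B →L[ℂ] T) (x : T →L[ℂ] T) (v w : B) (a a' : A) :
    ⟪a, compression τ x v w a'⟫_ℂ = ⟪τ a v, x (τ a' w)⟫_ℂ := by
  simp [compression, ContinuousLinearMap.adjoint_inner_right]

/-- The bounded sesquilinear form `(v, w) ↦ φ (compression τ x v w)` on `B`. -/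
def sliceForm (τ : A →L[ℂ] B →L[ℂ] T) (x : T →L[ℂ] T) (S : VonNeumannAlgebra A)
    (hx : ∀ v w, compression τ x v w ∈ S) (φ : StrongDual ℂ S) : B →L⋆[ℂ] B →L[ℂ] ℂ :=
  LinearMap.mkContinuous₂
    (LinearMap.mk₂'ₛₗ (starRingEnd ℂ) (RingHom.id ℂ)
      (fun v w ↦ φ ⟨compression τ x v w, hx v w⟩)
      (fun v v' w ↦ by
        rw [← map_add]; congr 1; ext1; simp [compression, ContinuousLinearMap.add_comp])
      (fun c v w ↦ by
        rw [← map_smul]; congr 1; ext1; simp only [compression, map_smul]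
        exact (congrArg (fun f ↦ f.comp (x.comp (τ.flip w)))
          (LinearIsometryEquiv.map_smulₛₗ ContinuousLinearMap.adjoint c (τ.flip v))))
      (fun v w w' ↦ by
        rw [← map_add]; congr 1; ext1; simp [compression, ContinuousLinearMap.comp_add])
      (fun c v w ↦ by
        simp only [RingHom.id_apply]
        rw [← map_smul]; congr 1; ext1; simp [compression]))
    (‖φ‖ * (‖τ.flip‖ * ‖x‖ * ‖τ.flip‖))
    (fun v w ↦ by
      refine (φ.le_opNorm _).trans ?_
      rw [mul_assoc, mul_assoc]
      refine mul_le_mul_of_nonneg_left ?_ (norm_nonneg φ)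
      change ‖compression τ x v w‖ ≤ _
      refine (ContinuousLinearMap.opNorm_comp_le _ _).trans ?_
      rw [LinearIsometryEquiv.norm_map]
      have h1 := τ.flip.le_opNorm v
      have h2 := τ.flip.le_opNorm w
      have h3 := ContinuousLinearMap.opNorm_comp_le x (τ.flip w)
      calc ‖τ.flip v‖ * ‖x.comp (τ.flip w)‖
          ≤ (‖τ.flip‖ * ‖v‖) * (‖x‖ * (‖τ.flip‖ * ‖w‖)) := by
            refine mul_le_mul h1 (h3.trans ?_) (norm_nonneg _) (by positivity)
            exact mul_le_mul_of_nonneg_left h2 (norm_nonneg _)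
        _ = _ := by ring)

/-- The operator on `B` with `⟪v, sliceOp τ x S hx φ w⟫ = φ (compression τ x v w)`. -/
def sliceOp [CompleteSpace B] (τ : A →L[ℂ] B →L[ℂ] T) (x : T →L[ℂ] T) (S : VonNeumannAlgebra A)
    (hx : ∀ v w, compression τ x v w ∈ S) (φ : StrongDual ℂ S) : B →L[ℂ] B :=
  ContinuousLinearMap.adjoint
    (InnerProductSpace.continuousLinearMapOfBilin (sliceForm τ x S hx φ))

theorem inner_sliceOp [CompleteSpace B] (τ : A →L[ℂ] B →L[ℂ] T) (x : T →L[ℂ] T) (S : VonNeumannAlgebra A)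
    (hx : ∀ v w, compression τ x v w ∈ S) (φ : StrongDual ℂ S) (v w : B) :
    ⟪v, sliceOp τ x S hx φ w⟫_ℂ = φ ⟨compression τ x v w, hx v w⟩ := by
  rw [sliceOp, ContinuousLinearMap.adjoint_inner_right,
    InnerProductSpace.continuousLinearMapOfBilin_apply]
  rfl

end Slice

section SliceMaps

variable {H K : Type*} [NormedAddCommGroup H] [InnerProductSpace ℂ H] [CompleteSpace H]
  [NormedAddCommGroup K] [InnerProductSpace ℂ K] [CompleteSpace K]
  {M : VonNeumannAlgebra H} {N : VonNeumannAlgebra K}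

theorem mem_of_commute_commutant (S : VonNeumannAlgebra H) {y : H →L[ℂ] H}
    (h : ∀ c ∈ S.commutant, c * y = y * c) : y ∈ S := by
  rw [← S.commutant_commutant, VonNeumannAlgebra.mem_commutant_iff]
  exact h

theorem one_mem_commutant (S : VonNeumannAlgebra H) : (1 : H →L[ℂ] H) ∈ S.commutant := one_mem _

theorem inner_opTensor_left (c : H →L[ℂ] H) (d : K →L[ℂ] K) (z z' : HilbertTensor H K) :
    ⟪z, opTensor c d z'⟫_ℂ = ⟪opTensor (star c) (star d) z, z'⟫_ℂ := by
  rw [← star_opTensor, ContinuousLinearMap.star_eq_adjoint,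
    ContinuousLinearMap.adjoint_inner_left]

theorem opTensor_apply_comm {x : HilbertTensor H K →L[ℂ] HilbertTensor H K}
    (hx : x ∈ vnTensor M N) {c : H →L[ℂ] H} {d : K →L[ℂ] K} (hc : c ∈ M.commutant)
    (hd : d ∈ N.commutant) (z : HilbertTensor H K) :
    x (opTensor c d z) = opTensor c d (x z) :=
  (congrArg (fun f ↦ f z) (vnTensor_comm hx hc hd)).symm

theorem compression_mem_left {x : HilbertTensor H K →L[ℂ] HilbertTensor H K}
    (hx : x ∈ vnTensor M N) (v w : K) : compression (tmulL H K) x v w ∈ M := by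
  refine mem_of_commute_commutant M fun c hc ↦ ?_
  ext a
  refine ext_inner_left ℂ fun a' ↦ ?_
  simp only [mul_apply_eq_comp]
  rw [← ContinuousLinearMap.adjoint_inner_left, inner_compression, inner_compression]
  have h1 : tmulL H K (c a) w = opTensor c 1 (tmulL H K a w) := by
    rw [opTensor_tmulL]; rfl
  rw [h1, opTensor_apply_comm hx hc (one_mem_commutant N), inner_opTensor_left, opTensor_tmulL]
  simp [ContinuousLinearMap.star_eq_adjoint]

theorem compression_mem_right {x : HilbertTensor H K →L[ℂ] HilbertTensor H K}
    (hx : x ∈ vnTensor M N) (v w : H) : compression (tmulL H K).flip x v w ∈ N := by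
  refine mem_of_commute_commutant N fun c hc ↦ ?_
  ext a
  refine ext_inner_left ℂ fun a' ↦ ?_
  simp only [mul_apply_eq_comp]
  rw [← ContinuousLinearMap.adjoint_inner_left, inner_compression, inner_compression]
  simp only [ContinuousLinearMap.flip_apply]
  have h1 : tmulL H K w (c a) = opTensor 1 c (tmulL H K w a) := by
    rw [opTensor_tmulL]; rfl
  rw [h1, opTensor_apply_comm hx (one_mem_commutant M) hc, inner_opTensor_left, opTensor_tmulL]
  simp [ContinuousLinearMap.star_eq_adjoint]

theorem sliceOp_mem_left {x : HilbertTensor H K →L[ℂ] HilbertTensor H K}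
    (hx : x ∈ vnTensor M N) (φ : StrongDual ℂ M) :
    sliceOp (tmulL H K) x M (compression_mem_left hx) φ ∈ N := by
  refine mem_of_commute_commutant N fun c hc ↦ ?_
  ext w
  refine ext_inner_left ℂ fun v ↦ ?_
  simp only [mul_apply_eq_comp]
  rw [← ContinuousLinearMap.adjoint_inner_left, inner_sliceOp, inner_sliceOp]
  congr 2
  ext a
  refine ext_inner_left ℂ fun a' ↦ ?_
  rw [inner_compression, inner_compression]
  have h1 : tmulL H K a (c w) = opTensor 1 c (tmulL H K a w) := by
    rw [opTensor_tmulL]; rfl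
  rw [h1, opTensor_apply_comm hx (one_mem_commutant M) hc, inner_opTensor_left, opTensor_tmulL]
  simp [ContinuousLinearMap.star_eq_adjoint]

theorem sliceOp_mem_right {x : HilbertTensor H K →L[ℂ] HilbertTensor H K}
    (hx : x ∈ vnTensor M N) (φ : StrongDual ℂ N) :
    sliceOp (tmulL H K).flip x N (compression_mem_right hx) φ ∈ M := by
  refine mem_of_commute_commutant M fun c hc ↦ ?_
  ext w
  refine ext_inner_left ℂ fun v ↦ ?_
  simp only [mul_apply_eq_comp]
  rw [← ContinuousLinearMap.adjoint_inner_left, inner_sliceOp, inner_sliceOp]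
  congr 2
  ext a
  refine ext_inner_left ℂ fun a' ↦ ?_
  rw [inner_compression, inner_compression]
  simp only [ContinuousLinearMap.flip_apply]
  have h1 : tmulL H K (c w) a = opTensor c 1 (tmulL H K w a) := by
    rw [opTensor_tmulL]; rfl
  rw [h1, opTensor_apply_comm hx hc (one_mem_commutant N), inner_opTensor_left, opTensor_tmulL]
  simp [ContinuousLinearMap.star_eq_adjoint]

/-- The left slice `(φ ⊗ id) x ∈ N` of `x ∈ M ⊗̄ N` by an arbitrary `φ ∈ M*`, not necessarily
normal. It is the operator determined by `ω_{v,w} ((φ ⊗ id) x) = φ ((id ⊗ ω_{v,w}) x)` for all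
`v, w ∈ K`. -/
def leftSlice (x : vnTensor M N) (φ : StrongDual ℂ M) : N :=
  ⟨sliceOp (tmulL H K) x M (compression_mem_left x.2) φ, sliceOp_mem_left x.2 φ⟩

/-- The right slice `(id ⊗ φ) x ∈ M` of `x ∈ M ⊗̄ N` by an arbitrary `φ ∈ N*`. It is the operator
determined by `ω_{v,w} ((id ⊗ φ) x) = φ ((ω_{v,w} ⊗ id) x)` for all `v, w ∈ H`. -/
def rightSlice (x : vnTensor M N) (φ : StrongDual ℂ N) : M :=
  ⟨sliceOp (tmulL H K).flip x N (compression_mem_right x.2) φ, sliceOp_mem_right x.2 φ⟩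

/-- On elementary tensors, `(φ ⊗ id) (a ⊗ b) = φ a • b`. -/
theorem leftSlice_opTensor (a : M) (b : N) (φ : StrongDual ℂ M) :
    leftSlice ⟨opTensor (a : H →L[ℂ] H) b, opTensor_mem_vnTensor a.2 b.2⟩ φ = φ a • b := by
  ext w
  refine ext_inner_left ℂ fun v ↦ ?_
  refine (inner_sliceOp _ _ _ _ φ v w).trans ?_
  have : (⟨_, compression_mem_left (opTensor_mem_vnTensor a.2 b.2) v w⟩ : M) =
      ⟪v, (b : K →L[ℂ] K) w⟫_ℂ • a := by
    ext h
    refine ext_inner_left ℂ fun h' ↦ ?_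
    rw [inner_compression, opTensor_tmulL, tmulL_apply, tmulL_apply,
      UniformSpace.Completion.inner_coe, TensorProduct.inner_tmul]
    change _ = ⟪h', ⟪v, (b : K →L[ℂ] K) w⟫_ℂ • (a : H →L[ℂ] H) h⟫_ℂ
    rw [inner_smul_right, mul_comm]
  rw [this, map_smul]
  change _ = ⟪v, φ a • (b : K →L[ℂ] K) w⟫_ℂ
  rw [inner_smul_right, smul_eq_mul, mul_comm]

/-- On elementary tensors, `(id ⊗ φ) (a ⊗ b) = φ b • a`. -/
theorem rightSlice_opTensor (a : M) (b : N) (φ : StrongDual ℂ N) :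
    rightSlice ⟨opTensor (a : H →L[ℂ] H) b, opTensor_mem_vnTensor a.2 b.2⟩ φ = φ b • a := by
  ext w
  refine ext_inner_left ℂ fun v ↦ ?_
  refine (inner_sliceOp _ _ _ _ φ v w).trans ?_
  have : (⟨_, compression_mem_right (opTensor_mem_vnTensor a.2 b.2) v w⟩ : N) =
      ⟪v, (a : H →L[ℂ] H) w⟫_ℂ • b := by
    ext h
    refine ext_inner_left ℂ fun h' ↦ ?_
    rw [inner_compression]
    simp only [ContinuousLinearMap.flip_apply]
    rw [opTensor_tmulL, tmulL_apply, tmulL_apply,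
      UniformSpace.Completion.inner_coe, TensorProduct.inner_tmul]
    change _ = ⟪h', ⟪v, (a : H →L[ℂ] H) w⟫_ℂ • (b : K →L[ℂ] K) h⟫_ℂ
    rw [inner_smul_right]
  rw [this, map_smul]
  change _ = ⟪v, φ b • (a : H →L[ℂ] H) w⟫_ℂ
  rw [inner_smul_right, smul_eq_mul, mul_comm]

end SliceMaps

/-! ### Functionals on a von Neumann algebra, and uniformity of maps on its dual -/

section Uniformity

universe u

variable {H : Type u} [NormedAddCommGroup H] [InnerProductSpace ℂ H] [CompleteSpace H]
  (M : VonNeumannAlgebra H)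

/-- The vector functional `ω_{v,w} : a ↦ ⟪v, a w⟫` on `M`. -/
def vectorFunctional (v w : H) : StrongDual ℂ M :=
  LinearMap.mkContinuous
    { toFun := fun a ↦ ⟪v, (a : H →L[ℂ] H) w⟫_ℂ
      map_add' := fun a b ↦ inner_add_right v _ _
      map_smul' := fun c a ↦ inner_smul_right v _ c }
    (‖v‖ * ‖w‖)
    (fun a ↦ by
      change ‖⟪v, (a : H →L[ℂ] H) w⟫_ℂ‖ ≤ ‖v‖ * ‖w‖ * ‖(a : H →L[ℂ] H)‖
      calc ‖⟪v, (a : H →L[ℂ] H) w⟫_ℂ‖ ≤ ‖v‖ * ‖(a : H →L[ℂ] H) w‖ := norm_inner_le_norm _ _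
        _ ≤ ‖v‖ * (‖(a : H →L[ℂ] H)‖ * ‖w‖) :=
          mul_le_mul_of_nonneg_left ((a : H →L[ℂ] H).le_opNorm w) (norm_nonneg v)
        _ = _ := by ring)

theorem vectorFunctional_apply (v w : H) (a : M) :
    vectorFunctional M v w a = ⟪v, (a : H →L[ℂ] H) w⟫_ℂ := rfl

/-- The weak* topology of `M` as the dual of its predual, i.e. the σ-weak (ultraweak) topology: the
coarsest for which all the functionals `a ↦ ∑ₙ ⟪vₙ, a wₙ⟫` with `∑ₙ ‖vₙ‖² < ∞` and
`∑ₙ ‖wₙ‖² < ∞` are continuous. -/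
abbrev sigmaWeakTopology : TopologicalSpace M :=
  ⨅ p : {p : (ℕ → H) × (ℕ → H) //
      (Summable fun n ↦ ‖p.1 n‖ ^ 2) ∧ Summable fun n ↦ ‖p.2 n‖ ^ 2},
    TopologicalSpace.induced (fun a : M ↦ ∑' n, ⟪p.1.1 n, (a : H →L[ℂ] H) (p.1.2 n)⟫_ℂ)
      inferInstance

/-- The weak operator topology of `M`. -/
abbrev weakOperatorTopology : TopologicalSpace M :=
  TopologicalSpace.induced
    (fun a : M ↦ (ContinuousLinearMapWOT.ofCLM (a : H →L[ℂ] H) : H →WOT[ℂ] H)) inferInstance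

/-- `φ` is weak*-continuous (normal), i.e. belongs to the predual `M_*`. -/
def IsWeakStarFunctional (φ : StrongDual ℂ M) : Prop :=
  Continuous[sigmaWeakTopology M, inferInstance] φ

/-- `φ` is weakly continuous, i.e. continuous for the weak operator topology. -/
def IsWeakFunctional (φ : StrongDual ℂ M) : Prop :=
  Continuous[weakOperatorTopology M, inferInstance] φ

variable {Y : Type*} [NormedAddCommGroup Y]

variable {M}

/-- Bounded uniformity of a map on `M*`: weak*-to-norm continuity on the unit ball of `M*`. -/
def UniformLeOne (F : StrongDual ℂ M → Y) : Prop :=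
  ContinuousOn (fun φ : WeakDual ℂ M ↦ F (WeakDual.toStrongDual φ))
    {φ | ‖WeakDual.toStrongDual φ‖ ≤ 1}

/-- Bounded uniformity with respect to nets of functionals in the class `P` converging to `0`:
norm-bounded nets of such functionals that converge to `0` in the weak* topology of `M*` are sent
to nets converging to `0` in norm. (Index sets in the universe of `M` suffice for all nets.) -/
def UniformOnNullNets (P : StrongDual ℂ M → Prop) (F : StrongDual ℂ M → Y) : Prop :=
  ∀ (ι : Type u) [Preorder ι] [IsDirectedOrder ι] [Nonempty ι] (φ : ι → StrongDual ℂ M),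
    (∀ i, P (φ i)) → (∃ C : ℝ, ∀ i, ‖φ i‖ ≤ C) →
    Tendsto (fun i ↦ StrongDual.toWeakDual (φ i)) atTop (𝓝 0) →
    Tendsto (fun i ↦ F (φ i)) atTop (𝓝 0)

/-- Norm-bounded nets of vector functionals `ω_{v,w}` that are weak*-Cauchy, i.e. Cauchy at each
element of `M`, are sent to norm-Cauchy nets. -/
def CauchyOnVectorFunctionals (F : StrongDual ℂ M → Y) : Prop :=
  ∀ (ι : Type u) [Preorder ι] [IsDirectedOrder ι] [Nonempty ι] (v w : ι → H),
    (∃ C : ℝ, ∀ i, ‖vectorFunctional M (v i) (w i)‖ ≤ C) →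
    (∀ a : M, CauchySeq fun i ↦ vectorFunctional M (v i) (w i) a) →
    CauchySeq fun i ↦ F (vectorFunctional M (v i) (w i))

end Uniformity

end

end VNSlice

/-! Everything reduces to total boundedness of two sets: the slices `(id ⊗ ω_{v,w}) x` in `M` and
the slices `(ω_{v,w} ⊗ id) x` in `N`, with `v, w` in the unit ball. The norm of `(φ ⊗ id) x` is the
supremum of `|φ|` over the first set, so the left slice map measures uniform convergence on that
set. If (a) holds on the left, the weak*-compact dual ball has a norm-compact image, and a
Schauder-type duality argument makes the first set totally bounded. Conversely, on a totally bounded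
set, bounded pointwise convergence of functionals is uniform, so (a) and (b) hold on that side.
Passing to (c) restricts the class of functionals, and (d) follows by taking differences along a
product net. The sides are linked by `leftSlice_vectorFunctional` and its mirror image: slicing on
the left by unit-ball vector functionals produces exactly the second set. An ultrafilter argument
shows that (d) on the left makes this set totally bounded, which gives (a) on the right. By symmetry
the eight conditions form a cycle. -/

namespace VNSlice

universe u

/-! ### Duality between total boundedness in a normed space and in its dual -/

section Norming

variable {E Y I : Type*} [NormedAddCommGroup E] [NormedSpace ℂ E] [NormedAddCommGroup Y]
  {g : I → E} {F : StrongDual ℂ E → Y}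

/-- If `F` maps the dual unit ball to a totally bounded set and its norm dominates the evaluations
at the points `g i` of a bounded family, then this family is totally bounded. -/
theorem totallyBounded_range_of_image_ball {C : ℝ} (hg : ∀ i, ‖g i‖ ≤ C)
    (hsub : ∀ φ ψ, F (φ - ψ) = F φ - F ψ) (hle : ∀ φ i, ‖φ (g i)‖ ≤ ‖F φ‖)
    (hF : TotallyBounded (F '' {φ | ‖φ‖ ≤ 1})) : TotallyBounded (Set.range g) := by
  rw [Metric.totallyBounded_iff]
  intro ε hε
  have h4 : (0 : ℝ) < ε / 4 := by positivity
  -- Finitely many functionals in the dual ball whose `F`-values are `ε / 4`-dense in the image of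
  -- the ball.
  obtain ⟨t, -, htf, ht⟩ := Set.exists_subset_image_finite_and.1
    (Metric.finite_approx_of_totallyBounded hF _ h4)
  have := htf.fintype
  -- Evaluation at these functionals sends the family to a bounded, hence totally bounded, subset of
  -- a finite-dimensional space. Indices with close images will turn out to give close points.
  let Φ : I → t → ℂ := fun i φ ↦ (φ : StrongDual ℂ E) (g i)
  have hΦ : Bornology.IsBounded (Set.range Φ) := by
    rw [Bornology.forall_isBounded_image_eval_iff.symm]
    rintro φ
    refine (Metric.isBounded_closedBall (x := (0 : ℂ)) (r := ‖(φ : StrongDual ℂ E)‖ * C)).subset ?_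
    rintro _ ⟨_, ⟨i, rfl⟩, rfl⟩
    rw [mem_closedBall_zero_iff]
    exact (ContinuousLinearMap.le_opNorm _ _).trans
      (mul_le_mul_of_nonneg_left (hg i) (norm_nonneg _))
  rw [← Set.image_univ] at hΦ
  obtain ⟨J, -, hJf, hJ⟩ := Set.exists_subset_image_finite_and.1
    (Metric.finite_approx_of_totallyBounded
      (hΦ.isCompact_closure.totallyBounded.subset subset_closure) _ h4)
  refine ⟨g '' J, hJf.image g, ?_⟩
  rintro _ ⟨i, rfl⟩
  obtain ⟨_, ⟨j, hj, rfl⟩, hij⟩ := Set.mem_iUnion₂.1 (hJ ⟨i, Set.mem_univ i, rfl⟩)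
  refine Set.mem_iUnion₂.2 ⟨g j, ⟨j, hj, rfl⟩, ?_⟩
  rw [Metric.mem_ball, dist_eq_norm]
  refine lt_of_le_of_lt (b := 3 * (ε / 4)) ?_ (by linarith)
  -- A Hahn–Banach functional attaining the norm of the difference is replaced by some `ψ ∈ t`. The
  -- replacement costs `ε / 4` at each of the two points, and `ψ` itself separates them by at most
  -- `ε / 4`.
  obtain ⟨φ, hφ1, hφ⟩ := exists_dual_vector'' ℂ (g i - g j)
  obtain ⟨_, ⟨ψ, hψ, rfl⟩, hφψ⟩ := Set.mem_iUnion₂.1 (ht ⟨φ, hφ1, rfl⟩)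
  rw [Metric.mem_ball, dist_eq_norm, ← hsub] at hφψ
  have h1 := (hle (φ - ψ) i).trans hφψ.le
  have h2 := (hle (φ - ψ) j).trans hφψ.le
  have h3 : ‖ψ (g i) - ψ (g j)‖ ≤ ε / 4 := by
    rw [← dist_eq_norm]
    exact (dist_le_pi_dist (Φ i) (Φ j) ⟨ψ, hψ⟩).trans (Metric.mem_ball.1 hij).le
  have h0 : ‖g i - g j‖ = ‖φ (g i - g j)‖ := by simp [hφ]
  have h5 : φ (g i - g j) = (φ - ψ) (g i) + (ψ (g i) - ψ (g j)) - (φ - ψ) (g j) := by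
    simp only [map_sub, sub_apply]; ring
  rw [h0, h5]
  linarith [norm_sub_le ((φ - ψ) (g i) + (ψ (g i) - ψ (g j))) ((φ - ψ) (g j)),
    norm_add_le ((φ - ψ) (g i)) (ψ (g i) - ψ (g j))]

/-- A bounded family of functionals converging to zero pointwise converges to zero uniformly on
totally bounded sets. -/
theorem tendsto_zero_of_totallyBounded {α : Type*} {l : Filter α} {C : ℝ}
    (hbound : ∀ φ (D : ℝ), 0 ≤ D → (∀ i, ‖φ (g i)‖ ≤ D) → ‖F φ‖ ≤ D)
    (hg : TotallyBounded (Set.range g)) {φ : α → StrongDual ℂ E} (hφ : ∀ᶠ a in l, ‖φ a‖ ≤ C)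
    (hlim : ∀ e, Tendsto (fun a ↦ φ a e) l (𝓝 0)) : Tendsto (fun a ↦ F (φ a)) l (𝓝 0) := by
  rw [NormedAddGroup.tendsto_nhds_zero]
  intro ε hε
  -- This radius makes moving to a centre cost at most `ε / 4`; `|C| + 1` is positive whatever the
  -- sign of `C`.
  have hδ : 0 < ε / (4 * (|C| + 1)) := by positivity
  obtain ⟨t, htf, ht⟩ := Metric.totallyBounded_iff.1 hg _ hδ
  have hev : ∀ᶠ a in l, ∀ e ∈ t, ‖φ a e‖ < ε / 4 :=
    (htf.eventually_all).2 fun e _ ↦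
      NormedAddGroup.tendsto_nhds_zero.1 (hlim e) _ (by positivity)
  filter_upwards [hev, hφ] with a ha hC
  refine (hbound (φ a) (ε / 2) (by positivity) fun i ↦ ?_).trans_lt (by linarith)
  obtain ⟨e, he, hie⟩ := Set.mem_iUnion₂.1 (ht ⟨i, rfl⟩)
  rw [Metric.mem_ball, dist_eq_norm] at hie
  have h1 : ‖φ a (g i - e)‖ ≤ ε / 4 := by
    calc ‖φ a (g i - e)‖ ≤ ‖φ a‖ * ‖g i - e‖ := (φ a).le_opNorm _
      _ ≤ (|C| + 1) * (ε / (4 * (|C| + 1))) :=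
        mul_le_mul (by linarith [le_abs_self C]) hie.le (norm_nonneg _) (by positivity)
      _ = ε / 4 := by field_simp
  have h2 : φ a (g i) = φ a (g i - e) + φ a e := by rw [map_sub]; ring
  rw [h2]
  linarith [norm_add_le (φ a (g i - e)) (φ a e), ha e he]

end Norming

/-! ### From filters to nets -/

section Nets

/-- The canonical index set of a net associated with a filter. -/
def NetIndex {I : Type u} (l : Filter I) : Type u := {q : Set I × I // q.1 ∈ l ∧ q.2 ∈ q.1}

namespace NetIndex

variable {I : Type u} (l : Filter I)

instance : Preorder (NetIndex l) := Preorder.lift fun q ↦ OrderDual.toDual q.1.1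

instance [l.NeBot] : IsDirectedOrder (NetIndex l) where
  directed p q := by
    have h := inter_mem p.2.1 q.2.1
    obtain ⟨i, hi⟩ := l.nonempty_of_mem h
    exact ⟨⟨(p.1.1 ∩ q.1.1, i), h, hi⟩, Set.inter_subset_left, Set.inter_subset_right⟩

instance [l.NeBot] : Nonempty (NetIndex l) :=
  let ⟨i⟩ := l.nonempty_of_neBot
  ⟨⟨(Set.univ, i), univ_mem, trivial⟩⟩

/-- Indices are pointed members of `l` ordered by reverse inclusion, so a tail of the net at `(s,
i)` visits exactly the points of subsets of `s` belonging to `l`. Filter arguments can thus be fed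
to hypotheses about nets without leaving the universe. -/
theorem map_atTop [l.NeBot] : map (fun q : NetIndex l ↦ q.1.2) atTop = l := by
  ext s
  rw [mem_map, mem_atTop_sets]
  constructor
  · rintro ⟨q, hq⟩
    exact mem_of_superset q.2.1 fun i hi ↦ hq ⟨(q.1.1, i), q.2.1, hi⟩ (le_refl q.1.1)
  · intro hs
    obtain ⟨i, hi⟩ := l.nonempty_of_mem hs
    exact ⟨⟨(s, i), hs, hi⟩, fun q (hq : q.1.1 ⊆ s) ↦ hq q.2.2⟩

end NetIndex

end Nets

/-! ### Vector functionals and the implications between the conditions -/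

section Functionals

variable {H : Type u} [NormedAddCommGroup H] [InnerProductSpace ℂ H] [CompleteSpace H]
  {M : VonNeumannAlgebra H} {Y : Type*} [NormedAddCommGroup Y] {F : StrongDual ℂ M → Y}

theorem norm_vectorFunctional_le (v w : H) : ‖vectorFunctional M v w‖ ≤ ‖v‖ * ‖w‖ :=
  LinearMap.mkContinuous_norm_le _ (by positivity) _

/-- The pairs of vectors in the unit ball. -/
abbrev BallPair (H : Type*) [NormedAddCommGroup H] : Type _ :=
  {p : H × H // ‖p.1‖ ≤ 1 ∧ ‖p.2‖ ≤ 1}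

theorem norm_vectorFunctional_le_one (p : BallPair H) :
    ‖vectorFunctional M p.1.1 p.1.2‖ ≤ 1 :=
  (norm_vectorFunctional_le _ _).trans (mul_le_one₀ p.2.1 (norm_nonneg _) p.2.2)

/-- The defining series with both sequences concentrated at index `0` is the single term `⟪v, a w⟫`.
-/
theorem continuous_inner_sigmaWeak (v w : H) :
    Continuous[sigmaWeakTopology M, inferInstance]
      fun a : M ↦ ⟪v, (a : H →L[ℂ] H) w⟫_ℂ := by
  have hs (v : H) : Summable fun n : ℕ ↦ ‖(Pi.single 0 v : ℕ → H) n‖ ^ 2 :=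
    (hasSum_single 0 fun n hn ↦ by simp [hn]).summable
  rw [continuous_iff_le_induced]
  refine (iInf_le _ ⟨(Pi.single 0 v, Pi.single 0 w), hs v, hs w⟩).trans_eq ?_
  congr 1
  ext a
  rw [tsum_eq_single 0 fun n hn ↦ by simp [hn]]
  simp

theorem IsWeakFunctional.isWeakStarFunctional {φ : StrongDual ℂ M} (h : IsWeakFunctional M φ) :
    IsWeakStarFunctional M φ := by
  refine continuous_le_dom (t₁ := weakOperatorTopology M) ?_ h
  rw [← continuous_iff_le_induced]
  let _ := sigmaWeakTopology M
  exact ContinuousLinearMapWOT.continuous_iff.2 fun w v ↦ continuous_inner_sigmaWeak v w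

theorem isWeakFunctional_vectorFunctional (v w : H) :
    IsWeakFunctional M (vectorFunctional M v w) := by
  have h : Continuous fun A : H →WOT[ℂ] H ↦ ⟪v, A w⟫_ℂ :=
    ContinuousLinearMapWOT.continuous_iff.1 continuous_id w v
  let _ := weakOperatorTopology M
  have h' : Continuous fun a : M ↦ ContinuousLinearMapWOT.ofCLM (a : H →L[ℂ] H) :=
    continuous_induced_dom
  exact h.comp h'

theorem IsWeakFunctional.sub {φ ψ : StrongDual ℂ M} (hφ : IsWeakFunctional M φ)
    (hψ : IsWeakFunctional M ψ) : IsWeakFunctional M (φ - ψ) :=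
  let _ := weakOperatorTopology M
  Continuous.sub (f := φ) (g := ψ) hφ hψ

theorem tendsto_toWeakDual_iff {E α : Type*} [NormedAddCommGroup E] [NormedSpace ℂ E]
    {l : Filter α} {φ : α → StrongDual ℂ E} {ψ : StrongDual ℂ E} :
    Tendsto (fun i ↦ StrongDual.toWeakDual (φ i)) l (𝓝 (StrongDual.toWeakDual ψ)) ↔
      ∀ e, Tendsto (fun i ↦ φ i e) l (𝓝 (ψ e)) :=
  tendsto_iff_forall_eval_tendsto_topDualPairing

theorem UniformOnNullNets.of_weakStar (h : UniformOnNullNets (IsWeakStarFunctional M) F) :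
    UniformOnNullNets (IsWeakFunctional M) F :=
  fun ι _ _ _ φ hφ ↦ h ι φ fun i ↦ (hφ i).isWeakStarFunctional

theorem UniformOnNullNets.cauchyOnVectorFunctionals
    (hsub : ∀ φ ψ, F (φ - ψ) = F φ - F ψ) (h : UniformOnNullNets (IsWeakFunctional M) F) :
    CauchyOnVectorFunctionals F := by
  rintro ι _ _ _ v w ⟨C, hC⟩ hcau
  let φ (i : ι) := vectorFunctional M (v i) (w i)
  have : IsDirectedOrder (ι × ι) := ⟨fun p q ↦
    let ⟨i, hi, hi'⟩ := exists_ge_ge p.1 q.1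
    let ⟨j, hj, hj'⟩ := exists_ge_ge p.2 q.2
    ⟨(i, j), ⟨hi, hj⟩, ⟨hi', hj'⟩⟩⟩
  -- A Cauchy net is one whose differences, indexed by pairs, tend to zero. A difference of vector
  -- functionals need not be a vector functional, but it is still weakly continuous.
  have key := h (ι × ι) (fun p ↦ φ p.1 - φ p.2)
    (fun p ↦ (isWeakFunctional_vectorFunctional _ _).sub (isWeakFunctional_vectorFunctional _ _))
    ⟨C + C, fun p ↦ (norm_sub_le _ _).trans (add_le_add (hC _) (hC _))⟩
    (tendsto_toWeakDual_iff (ψ := 0).2 fun a ↦ by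
      have := (cauchy_map_iff.1 (hcau a)).2
      rw [uniformity_eq_comap_nhds_zero_swapped, tendsto_comap_iff, prod_atTop_atTop_eq] at this
      exact this)
  refine cauchy_map_iff.2 ⟨inferInstance, ?_⟩
  rw [uniformity_eq_comap_nhds_zero_swapped, tendsto_comap_iff, prod_atTop_atTop_eq]
  simp only [hsub] at key
  exact key

/-- Along any ultrafilter on pairs of unit-ball vectors, the scalars `⟪v, a w⟫` lie in a compact
disc and so are Cauchy for every `a`. The hypothesis, applied to the associated net, makes the
images under `F` Cauchy. -/
theorem CauchyOnVectorFunctionals.totallyBounded (h : CauchyOnVectorFunctionals F) :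
    TotallyBounded (Set.range fun p : BallPair H ↦ F (vectorFunctional M p.1.1 p.1.2)) := by
  rw [totallyBounded_iff_ultrafilter]
  intro f hf
  rw [← Set.image_univ, le_principal_iff] at hf
  -- An ultrafilter on the range is the image of an ultrafilter on the index set of pairs.
  rw [← Ultrafilter.ofComapInfPrincipal_eq_of_map hf, Ultrafilter.coe_map]
  generalize Ultrafilter.ofComapInfPrincipal hf = U
  rw [← NetIndex.map_atTop (U : Filter (BallPair H)), map_map]
  refine h (NetIndex (U : Filter (BallPair H))) (fun q ↦ q.1.2.1.1) (fun q ↦ q.1.2.1.2)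
    ⟨1, fun q ↦ norm_vectorFunctional_le_one q.1.2⟩ fun a ↦ ?_
  have := (U.map fun p ↦ vectorFunctional M p.1.1 p.1.2 a).cauchy_of_totallyBounded
    (isCompact_closedBall (0 : ℂ) ‖a‖).totallyBounded (by
      rw [Ultrafilter.coe_map, le_principal_iff, mem_map]
      refine univ_mem' fun p ↦ mem_closedBall_zero_iff.2 ?_
      exact ((vectorFunctional M p.1.1 p.1.2).le_opNorm a).trans
        (mul_le_of_le_one_left (norm_nonneg _) (norm_vectorFunctional_le_one p)))
  rw [Ultrafilter.coe_map, ← NetIndex.map_atTop (U : Filter (BallPair H)), map_map] at this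
  exact this

section

variable {I : Type*} {g : I → M}

/-- By Banach–Alaoglu the dual ball is weak*-compact, so its image under `F` is norm-compact. -/
theorem UniformLeOne.totallyBounded {C : ℝ} (hF : UniformLeOne F) (hg : ∀ i, ‖g i‖ ≤ C)
    (hsub : ∀ φ ψ, F (φ - ψ) = F φ - F ψ) (hle : ∀ φ i, ‖φ (g i)‖ ≤ ‖F φ‖) :
    TotallyBounded (Set.range g) := by
  refine totallyBounded_range_of_image_ball hg hsub hle ?_
  have hK := WeakDual.isCompact_closedBall (𝕜 := ℂ) (E := M) 0 1
  have hs : (WeakDual.toStrongDual ⁻¹' Metric.closedBall (0 : StrongDual ℂ M) 1) =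
      {φ : WeakDual ℂ M | ‖WeakDual.toStrongDual φ‖ ≤ 1} := by ext; simp
  rw [hs] at hK
  refine (hK.image_of_continuousOn hF).totallyBounded.subset ?_
  rintro _ ⟨φ, hφ, rfl⟩
  exact ⟨StrongDual.toWeakDual φ, hφ, rfl⟩

theorem uniformLeOne_of_totallyBounded (hsub : ∀ φ ψ, F (φ - ψ) = F φ - F ψ)
    (hbound : ∀ φ (D : ℝ), 0 ≤ D → (∀ i, ‖φ (g i)‖ ≤ D) → ‖F φ‖ ≤ D)
    (hg : TotallyBounded (Set.range g)) : UniformLeOne F := by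
  intro φ₀ hφ₀
  rw [ContinuousWithinAt, tendsto_iff_norm_sub_tendsto_zero]
  simp_rw [← hsub]
  rw [← tendsto_zero_iff_norm_tendsto_zero]
  -- The differences `φ - φ₀` of two elements of the dual ball have norm at most `1 + 1`.
  refine tendsto_zero_of_totallyBounded (C := 1 + 1) hbound hg ?_ fun e ↦ ?_
  · filter_upwards [self_mem_nhdsWithin] with φ hφ
    exact (norm_sub_le _ _).trans (add_le_add hφ hφ₀)
  · have := tendsto_toWeakDual_iff.1 (tendsto_id (x := 𝓝 φ₀)) e
    rw [← sub_self (φ₀ e)]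
    exact (this.mono_left nhdsWithin_le_nhds).sub_const (φ₀ e)

theorem uniformOnNullNets_of_totallyBounded (P : StrongDual ℂ M → Prop)
    (hbound : ∀ φ (D : ℝ), 0 ≤ D → (∀ i, ‖φ (g i)‖ ≤ D) → ‖F φ‖ ≤ D)
    (hg : TotallyBounded (Set.range g)) : UniformOnNullNets P F := by
  rintro ι _ _ _ φ - ⟨C, hC⟩ hφ
  exact tendsto_zero_of_totallyBounded hbound hg (Eventually.of_forall hC)
    (tendsto_toWeakDual_iff (ψ := 0).1 hφ)

end

end Functionals

/-! ### Norms of slices, and exchange of the two sides -/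

section SliceOp

variable {A B T : Type*} [NormedAddCommGroup A] [InnerProductSpace ℂ A] [CompleteSpace A]
  [NormedAddCommGroup B] [InnerProductSpace ℂ B]
  [NormedAddCommGroup T] [InnerProductSpace ℂ T] [CompleteSpace T]
  (τ : A →L[ℂ] B →L[ℂ] T) (x : T →L[ℂ] T) {S : VonNeumannAlgebra A}
  (hx : ∀ v w, compression τ x v w ∈ S)

theorem norm_compression_le (v w : B) :
    ‖compression τ x v w‖ ≤ ‖τ.flip‖ * ‖v‖ * (‖x‖ * (‖τ.flip‖ * ‖w‖)) := by
  refine (ContinuousLinearMap.opNorm_comp_le _ _).trans ?_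
  rw [LinearIsometryEquiv.norm_map]
  exact mul_le_mul (τ.flip.le_opNorm v) ((ContinuousLinearMap.opNorm_comp_le _ _).trans
    (mul_le_mul_of_nonneg_left (τ.flip.le_opNorm w) (norm_nonneg _))) (norm_nonneg _)
    (by positivity)

/-- The compressions by pairs of vectors in the unit ball. -/
noncomputable def ballCompression (p : BallPair B) : S := ⟨compression τ x p.1.1 p.1.2, hx _ _⟩

theorem norm_ballCompression_le (p : BallPair B) :
    ‖ballCompression τ x hx p‖ ≤ ‖τ.flip‖ * (‖x‖ * ‖τ.flip‖) := by
  refine (norm_compression_le τ x p.1.1 p.1.2).trans ?_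
  have h := norm_nonneg τ.flip
  gcongr
  · exact mul_le_of_le_one_right h p.2.1
  · exact mul_le_of_le_one_right h p.2.2

variable [CompleteSpace B]

theorem sliceOp_sub (φ ψ : StrongDual ℂ S) :
    sliceOp τ x S hx (φ - ψ) = sliceOp τ x S hx φ - sliceOp τ x S hx ψ := by
  ext w
  refine ext_inner_left ℂ fun v ↦ ?_
  rw [sub_apply, inner_sub_right, inner_sliceOp, inner_sliceOp, inner_sliceOp, sub_apply]

theorem norm_apply_ballCompression_le (φ : StrongDual ℂ S) (p : BallPair B) :
    ‖φ (ballCompression τ x hx p)‖ ≤ ‖sliceOp τ x S hx φ‖ := by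
  rw [ballCompression, ← inner_sliceOp τ x S hx φ]
  refine (norm_inner_le_norm _ _).trans ?_
  have h := (sliceOp τ x S hx φ).unit_le_opNorm p.1.2 p.2.2
  exact (mul_le_of_le_one_left (norm_nonneg _) p.2.1).trans h

/-- The values of `φ` on the ball compressions are the matrix coefficients of the slice at unit-ball
vectors, which determine its norm. With `norm_apply_ballCompression_le` this makes the norm the
supremum of these values. -/
theorem norm_sliceOp_le {φ : StrongDual ℂ S} {D : ℝ} (hD : 0 ≤ D)
    (h : ∀ p, ‖φ (ballCompression τ x hx p)‖ ≤ D) : ‖sliceOp τ x S hx φ‖ ≤ D := by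
  refine ContinuousLinearMap.opNorm_le_of_re_inner_le hD fun w v hw hv ↦ ?_
  refine (RCLike.re_le_norm _).trans ?_
  rw [norm_inner_symm, inner_sliceOp]
  exact h ⟨(v, w), hv.le, hw.le⟩

/-- Slicing the two legs by vector functionals in either order gives the same coefficient of `x`.
This identity carries information from one side to the other. -/
theorem sliceOp_vectorFunctional (v w : A) :
    sliceOp τ x S hx (vectorFunctional S v w) = compression τ.flip x v w := by
  ext b
  refine ext_inner_left ℂ fun b' ↦ ?_
  rw [inner_sliceOp, vectorFunctional_apply, inner_compression, inner_compression]
  rfl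

end SliceOp

/-! ### The left and right slice maps -/

section Slices

variable {H K : Type*} [NormedAddCommGroup H] [InnerProductSpace ℂ H] [CompleteSpace H]
  [NormedAddCommGroup K] [InnerProductSpace ℂ K] [CompleteSpace K]
  {M : VonNeumannAlgebra H} {N : VonNeumannAlgebra K} (x : vnTensor M N)

/-- The slices `(id ⊗ ω_{v,w}) x` for `v, w` in the unit ball. -/
noncomputable def leftCompressions : BallPair K → M :=
  ballCompression (tmulL H K) x.1 (compression_mem_left x.2)

/-- The slices `(ω_{v,w} ⊗ id) x` for `v, w` in the unit ball. -/
noncomputable def rightCompressions : BallPair H → N :=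
  ballCompression (tmulL H K).flip x.1 (compression_mem_right x.2)

theorem leftSlice_sub (φ ψ : StrongDual ℂ M) :
    leftSlice x (φ - ψ) = leftSlice x φ - leftSlice x ψ :=
  Subtype.ext (sliceOp_sub _ _ _ φ ψ)

theorem rightSlice_sub (φ ψ : StrongDual ℂ N) :
    rightSlice x (φ - ψ) = rightSlice x φ - rightSlice x ψ :=
  Subtype.ext (sliceOp_sub _ _ _ φ ψ)

theorem norm_leftSlice_le (φ : StrongDual ℂ M) (D : ℝ) (hD : 0 ≤ D)
    (h : ∀ p, ‖φ (leftCompressions x p)‖ ≤ D) : ‖leftSlice x φ‖ ≤ D :=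
  norm_sliceOp_le _ _ _ hD h

theorem norm_rightSlice_le (φ : StrongDual ℂ N) (D : ℝ) (hD : 0 ≤ D)
    (h : ∀ p, ‖φ (rightCompressions x p)‖ ≤ D) : ‖rightSlice x φ‖ ≤ D :=
  norm_sliceOp_le _ _ _ hD h

theorem leftSlice_vectorFunctional (p : BallPair H) :
    leftSlice x (vectorFunctional M p.1.1 p.1.2) = rightCompressions x p :=
  Subtype.ext (sliceOp_vectorFunctional _ _ _ _ _)

theorem rightSlice_vectorFunctional (p : BallPair K) :
    rightSlice x (vectorFunctional N p.1.1 p.1.2) = leftCompressions x p :=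
  Subtype.ext (sliceOp_vectorFunctional _ _ _ _ _)

theorem totallyBounded_leftCompressions (h : UniformLeOne (leftSlice x)) :
    TotallyBounded (Set.range (leftCompressions x)) :=
  h.totallyBounded (norm_ballCompression_le _ _ _) (leftSlice_sub x)
    (norm_apply_ballCompression_le _ _ _)

theorem totallyBounded_rightCompressions (h : UniformLeOne (rightSlice x)) :
    TotallyBounded (Set.range (rightCompressions x)) :=
  h.totallyBounded (norm_ballCompression_le _ _ _) (rightSlice_sub x)
    (norm_apply_ballCompression_le _ _ _)

/-- The change of sides: the left slices by unit-ball vector functionals are the very family that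
norms the right slice map. -/
theorem uniformLeOne_rightSlice (h : CauchyOnVectorFunctionals (leftSlice x)) :
    UniformLeOne (rightSlice x) := by
  have := h.totallyBounded
  simp only [leftSlice_vectorFunctional] at this
  exact uniformLeOne_of_totallyBounded (rightSlice_sub x) (norm_rightSlice_le x) this

theorem uniformLeOne_leftSlice (h : CauchyOnVectorFunctionals (rightSlice x)) :
    UniformLeOne (leftSlice x) := by
  have := h.totallyBounded
  simp only [rightSlice_vectorFunctional] at this
  exact uniformLeOne_of_totallyBounded (leftSlice_sub x) (norm_leftSlice_le x) this

end Slices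

end VNSlice

theorem mainTheorem6 {H : Type*} {K : Type*}
    [NormedAddCommGroup H] [InnerProductSpace ℂ H] [CompleteSpace H]
    [NormedAddCommGroup K] [InnerProductSpace ℂ K] [CompleteSpace K]
    (M : VonNeumannAlgebra H) (N : VonNeumannAlgebra K) (x : VNSlice.vnTensor M N) :
    List.TFAE [
      VNSlice.UniformLeOne (VNSlice.leftSlice x),
      VNSlice.UniformOnNullNets (VNSlice.IsWeakStarFunctional M) (VNSlice.leftSlice x),
      VNSlice.UniformOnNullNets (VNSlice.IsWeakFunctional M) (VNSlice.leftSlice x),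
      VNSlice.CauchyOnVectorFunctionals (VNSlice.leftSlice x),
      VNSlice.UniformLeOne (VNSlice.rightSlice x),
      VNSlice.UniformOnNullNets (VNSlice.IsWeakStarFunctional N) (VNSlice.rightSlice x),
      VNSlice.UniformOnNullNets (VNSlice.IsWeakFunctional N) (VNSlice.rightSlice x),
      VNSlice.CauchyOnVectorFunctionals (VNSlice.rightSlice x)] := by
  tfae_have 1 → 2 := fun h ↦ VNSlice.uniformOnNullNets_of_totallyBounded _
    (VNSlice.norm_leftSlice_le x) (VNSlice.totallyBounded_leftCompressions x h)
  tfae_have 2 → 3 := fun h ↦ h.of_weakStar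
  tfae_have 3 → 4 := fun h ↦ h.cauchyOnVectorFunctionals (VNSlice.leftSlice_sub x)
  tfae_have 4 → 5 := VNSlice.uniformLeOne_rightSlice x
  tfae_have 5 → 6 := fun h ↦ VNSlice.uniformOnNullNets_of_totallyBounded _
    (VNSlice.norm_rightSlice_le x) (VNSlice.totallyBounded_rightCompressions x h)
  tfae_have 6 → 7 := fun h ↦ h.of_weakStar
  tfae_have 7 → 8 := fun h ↦ h.cauchyOnVectorFunctionals (VNSlice.rightSlice_sub x)
  tfae_have 8 → 1 := VNSlice.uniformLeOne_leftSlice x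
  tfae_finish
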